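/- A directed set (a partially ordered set in which every finite subset has an upper bound) $P$ has \emph{calibre $(\omega_1,\omega)$} if every uncountable subset of $P$ contains an infinite subset with an upper bound in $P$. It is \emph{productively calibre $(\omega_1,\omega)$} if $P\times Q$ has calibre $(\omega_1,\omega)$ for every directed set $Q$ of calibre $(\omega_1,\omega)$, and \emph{powerfully calibre $(\omega_1,\omega)$} if the countable power $P^\omega$, ordered coordinatewise, has calibre $(\omega_1,\omega)$. Let $\omega_1$ carry the order topology and let $I$ be the set of its isolated points. For $S\subseteq\omega_1$ let $M(\omega_1,S)$ be $\omega_1$ with its topology refined by isolating every point of $S$. For a topological space $X$ let $\mathcal{K}(X)$ be the set of all compact subsets of $X$, ordered by inclusion. There is a partition $\omega_1=\bigcup_{n<\omega}S_n'$ of $\omega_1$ into countably infinitely many pairwise disjoint stationary sets. For every such partition, put $S_n=S_n'\cup I$ and $X=\bigoplus_{n<\omega}M(\omega_1,S_n)$ (topological sum). Then $\mathcal{K}(X)$ is a directed set which has calibre $(\omega_1,\omega)$ but is neither powerfully calibre $(\omega_1,\omega)$ nor productively calibre $(\omega_1,\omega)$. In particular, there is a directed set which has calibre $(\omega_1,\omega)$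 but is neither powerfully nor productively calibre $(\omega_1,\omega)$. -/

import Mathlib

/-! ### Directed sets and calibre `(ω₁, ω)` -/

/-- A partially ordered set is a directed set if each of its finite subsets has an upper bound. -/
def IsDirectedSet (P : Type*) [PartialOrder P] : Prop :=
  ∀ F : Set P, F.Finite → BddAbove F

/-- Calibre `(ω₁, ω)`: every uncountable subset contains an infinite bounded subset. -/
def HasCalibre (P : Type*) [PartialOrder P] : Prop :=
  ∀ A : Set P, ¬ A.Countable → ∃ B ⊆ A, B.Infinite ∧ BddAbove B

/-- `P × Q` has calibre `(ω₁, ω)` for every directed set `Q` with calibre `(ω₁, ω)`. -/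
def IsProductivelyCalibre.{u} (P : Type u) [PartialOrder P] : Prop :=
  ∀ (Q : Type u) [PartialOrder Q], IsDirectedSet Q → HasCalibre Q → HasCalibre (P × Q)

/-- The countable power `P ^ ω`, with the coordinatewise order, has calibre `(ω₁, ω)`. -/
def IsPowerfullyCalibre (P : Type*) [PartialOrder P] : Prop :=
  HasCalibre (ℕ → P)

/-! ### The spaces -/

/-- The set `ω₁` of all countable ordinals. -/
abbrev OmegaOne : Type := (Ordinal.omega.{0} 1).ToType

/-- `ω₁` carries the order topology. -/
noncomputable instance : TopologicalSpace OmegaOne := Preorder.topology OmegaOne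

instance : OrderTopology OmegaOne := ⟨rfl⟩

/-- `IsolatedRefinement X S` is the space `M(X, S)`: the set `X` whose topology is that of `X`
refined by isolating the points of `S`. -/
def IsolatedRefinement (X : Type*) (_S : Set X) : Type _ := X

/-- The coarsest topology which is finer than that of `X` and makes every point of `S` isolated
(in Mathlib's order on topologies, `⊓` is the coarsest common refinement). -/
instance (X : Type*) [t : TopologicalSpace X] (S : Set X) :
    TopologicalSpace (IsolatedRefinement X S) :=
  t ⊓ TopologicalSpace.generateFrom {V : Set X | ∃ x ∈ S, V = {x}}

/-- The set of isolated points of a space. -/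
def isolatedPoints (X : Type*) [TopologicalSpace X] : Set X :=
  {x | IsOpen ({x} : Set X)}

/-- `S 0, S 1, S 2, …` is a partition of `ω₁` into stationary sets. -/
structure IsStationaryPartition (S : ℕ → Set OmegaOne) : Prop where
  stationary : ∀ n, IsStationary (S n)
  disjoint : Pairwise fun m n => Disjoint (S m) (S n)
  iUnion_eq : ⋃ n, S n = Set.univ

/-- The disjoint topological sum `⨁ₙ M(ω₁, Sₙ ∪ I)`, with `I` the isolated points of `ω₁`. -/
abbrev SumSpace (S : ℕ → Set OmegaOne) : Type :=
  Σ n : ℕ, IsolatedRefinement OmegaOne (S n ∪ isolatedPoints OmegaOne)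

/-!
For a space `X` with a suitable continuous map to `ω₁`, calibre `(ω₁, ω)` of `𝒦(X)` is governed by
the points of `ω₁` at which compact sets may accumulate.

*Where the calibre comes from* (`exists_infinite_bddAbove_compacts`). Let `K α`, `α < ω₁`, be
distinct compact sets in `X`. Over each initial segment `[0, γ]` the space is second countable, so
countably many open sets suffice to describe all neighbourhoods of compact sets there. A
closing-off argument gives a club of ordinals `δ` such that each neighbourhood of the part of
`K δ` over `[0, γ]`, with `γ < δ`, contains the corresponding part of some `K α` with `γ < α < δ`
whose image in `ω₁` lies below `δ`. For such a `δ`, some sequence of the `K α` converges to the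
part of `K δ` below `δ`, apart from pieces that move up to `δ`. If the fibre of `X` over `δ`
absorbs these pieces, as it does when `δ` is not isolated, then the sequence has a compact upper
bound. So it suffices that the admissible `δ` form a stationary set. In the sum of the
`M(ω₁, S'ₙ ∪ I)`, where the `S'ₙ` form the given partition and `I` is the set of isolated points,
a compact set meets finitely many summands, and some `m` works for uncountably many members of the
family.
The limit points in `S'ₘ₊₁` are isolated in none of the summands with index at most `m`, and
`S'ₘ₊₁` is stationary.

*Where it fails* (`IsolatedRefinement.notMem_of_isCompact`). If a compact subset of `M(ω₁, S)`
contains a set that accumulates at `δ` from below, then `δ ∉ S`. Consider the points of `𝒦(X) ^ ω`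
whose `n`-th coordinate is the singleton of the copy of `α` in the `n`-th summand. A bounded
infinite set of these would have an accumulation point `δ` outside every `S'ₙ`, but the `S'ₙ`
cover `ω₁`. Likewise `Q = 𝒦(M(ω₁, ω₁ ∖ S'₀))` has calibre `(ω₁, ω)` since `S'₀` is stationary, but
in `𝒦(X) × Q` an infinite bounded set of pairs of singletons of `α` would have an accumulation
point neither in `S'₀` nor outside it.

The partition into stationary sets is read off from an Ulam matrix.
-/

open Set Filter Topology TopologicalSpace Cardinal

/-! ### Countability and closed unbounded sets in `ω₁` -/

namespace OmegaOne

theorem cof_eq : Order.cof OmegaOne = ℵ₁ := by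
  rw [Ordinal.cof_toType, ← ord_aleph]
  exact isRegular_aleph_one.cof_ord

theorem cof_ne_aleph0 : Order.cof OmegaOne ≠ ℵ₀ := by
  rw [cof_eq]
  exact aleph0_lt_aleph_one.ne'

instance : Nonempty OmegaOne :=
  Ordinal.nonempty_toType_iff.2 (Ordinal.omega_pos 1).ne'

theorem bddAbove_of_countable {A : Set OmegaOne} (hA : A.Countable) : BddAbove A := by
  refine .of_not_isCofinal fun h => (Order.cof_le h).not_gt ?_
  rw [cof_eq]
  exact (le_aleph0_iff_set_countable.2 hA).trans_lt aleph0_lt_aleph_one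

theorem mk_eq : #OmegaOne = ℵ₁ := by simp

theorem countable_Iio (a : OmegaOne) : (Iio a).Countable := by
  have h := lt_ord.1 ((Ordinal.typein_lt_self a).trans_eq (ord_aleph 1).symm)
  rw [Ordinal.card_typein, ← succ_aleph0, Order.lt_succ_iff] at h
  exact le_aleph0_iff_set_countable.1 h

instance : Uncountable OmegaOne := by
  rw [← aleph0_lt_mk_iff, mk_eq]
  exact aleph0_lt_aleph_one

instance : NoMaxOrder OmegaOne where
  exists_gt a := by
    by_contra! h
    refine not_countable (α := OmegaOne) (countable_univ_iff.1 ?_)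
    exact ((countable_Iio a).union (countable_singleton a)).mono fun x _ =>
      (h x).lt_or_eq.imp_right fun h => h

theorem countable_Iic (a : OmegaOne) : (Iic a).Countable := by
  rw [← Order.Iio_succ]
  exact countable_Iio _

theorem exists_forall_lt {ι : Sort*} [Countable ι] (f : ι → OmegaOne) : ∃ b, ∀ i, f i < b := by
  obtain ⟨b, hb⟩ := bddAbove_of_countable (countable_range f)
  exact ⟨Order.succ b, fun i => Order.lt_succ_of_le (hb ⟨i, rfl⟩)⟩

/-- The limit ordinals closed under a given function form a club. This is the closing-off step of
the calibre argument. -/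
theorem isClub_setOf_closed (g : OmegaOne → OmegaOne) :
    IsClub {δ : OmegaOne | Order.IsSuccLimit δ ∧ ∀ α < δ, g α < δ} := by
  constructor
  · intro d hd hne _ x hx
    rcases em (x ∈ d) with h | h
    · exact hd h
    have key : ∀ α < x, ∃ δ ∈ d, α < δ ∧ δ < x := fun α hα => by
      obtain ⟨δ, hδ, h1, h2⟩ := hx.exists_between hα
      exact ⟨δ, hδ, h1, h2.lt_of_ne fun e => h (e ▸ hδ)⟩
    refine ⟨?_, fun α hα => ?_⟩
    · rw [Order.isSuccLimit_iff]
      refine ⟨fun hm => ?_, ?_⟩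
      · obtain ⟨y, hy⟩ := hne
        have : y < x := (hx.1 hy).lt_of_ne fun e => h (e ▸ hy)
        exact hm.not_lt this
      · rw [Order.isSuccPrelimit_iff_succ_lt]
        intro α hα
        obtain ⟨δ, hδ, h1, h2⟩ := key α hα
        exact (Order.succ_le_of_lt h1).trans_lt h2
    · obtain ⟨δ, hδ, h1, h2⟩ := key α hα
      exact ((hd hδ).2 α h1).trans h2
  · intro a
    have hex (b : OmegaOne) : ∃ c, ∀ x : Iic b, max x.1 (g x) < c :=
      have : Countable (Iic b) := countable_Iic b
      exists_forall_lt _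
    choose s hs using hex
    have hs' : ∀ b, ∀ x ≤ b, x < s b ∧ g x < s b := fun b x hx => max_lt_iff.1 (hs b ⟨x, hx⟩)
    -- `s b` exceeds all `x ≤ b` and their values; the supremum of its iterates is closed under `g`.
    let u : ℕ → OmegaOne := fun n => s^[n] a
    have hu : ∀ n, u (n + 1) = s (u n) := fun n => Function.iterate_succ_apply' s n a
    obtain ⟨δ, hδ⟩ : ∃ δ, IsLUB (range u) δ :=
      let ⟨δ, h1, h2⟩ := WellFounded.has_min (wellFounded_lt (α := OmegaOne))
        (upperBounds (range u)) (bddAbove_of_countable (countable_range u))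
      ⟨δ, h1, fun y hy => not_lt.1 (h2 y hy)⟩
    have hlt : ∀ n, u n < δ := fun n =>
      ((hs' _ _ le_rfl).1.trans_eq (hu n).symm).trans_le (hδ.1 ⟨n + 1, rfl⟩)
    have hcof : ∀ α < δ, ∃ n, α < u n := fun α hα => by
      obtain ⟨_, ⟨n, rfl⟩, h⟩ := (lt_isLUB_iff hδ).1 hα
      exact ⟨n, h⟩
    refine ⟨δ, ⟨(Order.isSuccLimit_iff _).2 ⟨fun hm => hm.not_lt (hlt 0), ?_⟩, fun α hα => ?_⟩,
      hδ.1 ⟨0, rfl⟩⟩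
    · rw [Order.isSuccPrelimit_iff_succ_lt]
      intro α hα
      obtain ⟨n, hn⟩ := hcof α hα
      exact (Order.succ_le_of_lt hn).trans_lt (hlt n)
    · obtain ⟨n, hn⟩ := hcof α hα
      exact ((hs' _ _ hn.le).2.trans_eq (hu n).symm).trans (hlt _)

theorem isStationary_Ioi (β : OmegaOne) : IsStationary (Ioi β) := by
  apply IsStationary.of_not_isCofinal_compl
  intro h
  obtain ⟨x, hx⟩ := exists_gt β
  obtain ⟨y, hy, hxy⟩ := h x
  exact hy (hx.trans_le hxy)

/-! ### A partition of `ω₁` into stationary sets -/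

/-- An Ulam matrix: fix injections `f α : α → ω`. For each `β`, the sets `{α > β | f α β = n}`
with `n < ω` cover a final segment of `ω₁`, so one of them is stationary. Some `n` serves for
infinitely many `β`, and for fixed `n` these sets are pairwise disjoint because each `f α` is
injective. -/
theorem exists_isStationaryPartition : ∃ S : ℕ → Set OmegaOne, IsStationaryPartition S := by
  have hinj (α : OmegaOne) : ∃ f : OmegaOne → ℕ, InjOn f (Iio α) :=
    countable_iff_exists_injOn.1 (countable_Iio α)
  choose f hf using hinj
  let A : OmegaOne → ℕ → Set OmegaOne := fun β n => {α | β < α ∧ f α β = n}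
  have hA : ∀ β, ∃ n, IsStationary (A β n) := fun β => by
    rw [← isStationary_iUnion_iff_of_countable cof_ne_aleph0]
    exact (isStationary_Ioi β).mono fun α hα => mem_iUnion.2 ⟨f α β, hα, rfl⟩
  choose n hn using hA
  obtain ⟨k, hk⟩ : ∃ k, ¬ (n ⁻¹' {k}).Countable := by
    by_contra! h
    refine not_countable (α := OmegaOne) (countable_univ_iff.1 ?_)
    refine (countable_iUnion h).mono fun x _ => mem_iUnion.2 ⟨n x, rfl⟩
  have hinf : (n ⁻¹' {k}).Infinite := fun h => hk h.countable
  let e := hinf.natEmbedding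
  have hst : ∀ i, IsStationary (A (e i) k) := fun i => by
    have := hn (e i)
    rwa [show n (e i) = k from (e i).2] at this
  have hdisj : Pairwise fun i j => Disjoint (A (e i) k) (A (e j) k) := fun i j hij => by
    refine Set.disjoint_left.2 ?_
    rintro α ⟨h1, h2⟩ ⟨h3, h4⟩
    exact hij (e.injective (Subtype.ext (hf α h1 h3 (h2.trans h4.symm))))
  -- The points that lie in none of these sets are added to the first one.
  refine ⟨fun i => A (e i) k ∪ {α | i = 0 ∧ ∀ j, α ∉ A (e j) k}, ?_, ?_, ?_⟩
  · exact fun i => (hst i).mono subset_union_left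
  · intro i j hij
    have := Set.disjoint_left.1 (hdisj hij)
    refine Set.disjoint_left.2 ?_
    rintro α (h1 | ⟨h1, h1'⟩) (h2 | ⟨h2, h2'⟩)
    · exact this h1 h2
    · exact h2' _ h1
    · exact h1' _ h2
    · exact hij (h1.trans h2.symm)
  · refine eq_univ_of_forall fun α => mem_iUnion.2 ?_
    by_cases h : ∃ j, α ∈ A (e j) k
    · exact h.imp fun j hj => Or.inl hj
    · exact ⟨0, Or.inr ⟨rfl, not_exists.1 h⟩⟩

/-! ### The order topology of `ω₁` -/

theorem isClopen_Iic (a : OmegaOne) : IsClopen (Iic a) := by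
  refine ⟨isClosed_Iic, ?_⟩
  rw [← Order.Iio_succ]
  exact isOpen_Iio

instance : FirstCountableTopology OmegaOne where
  nhds_generated_countable a := by
    have : Countable (Iio a) := countable_Iio a
    have h : 𝓝 a = (⨅ b : Iio a, 𝓟 (Ioi b.1)) ⊓ 𝓟 (Iic a) := by
      refine le_antisymm (le_inf ?_ ?_) ?_
      · exact le_iInf fun b => le_principal_iff.2 (Ioi_mem_nhds b.2)
      · exact le_principal_iff.2 ((isClopen_Iic a).isOpen.mem_nhds self_mem_Iic)
      · rw [nhds_eq_order, iInf_subtype']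
        refine inf_le_inf_left _ (le_iInf₂ fun b hb => ?_)
        exact principal_mono.2 (Iic_subset_Iio.2 hb)
    rw [h]
    infer_instance

theorem exists_Ioc_subset_of_mem_nhds {δ : OmegaOne} (hδ : Order.IsSuccLimit δ) {U : Set OmegaOne}
    (hU : U ∈ 𝓝 δ) : ∃ γ < δ, Ioc γ δ ⊆ U := by
  refine _root_.exists_Ioc_subset_of_mem_nhds hU ?_
  by_contra! h
  exact hδ.1 fun b _ => h b

theorem notMem_isolatedPoints {δ : OmegaOne} (hδ : Order.IsSuccLimit δ) :
    δ ∉ isolatedPoints OmegaOne := fun h => by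
  obtain ⟨γ, hγ, hs⟩ := exists_Ioc_subset_of_mem_nhds hδ (IsOpen.mem_nhds h (mem_singleton δ))
  have h1 := hδ.succ_lt hγ
  exact h1.ne (mem_singleton_iff.1 (hs ⟨Order.lt_succ γ, h1.le⟩))

/-- An infinite set of countable ordinals accumulates from below at some `δ`: take the least `δ`
with infinitely many elements of the set below it. -/
theorem exists_infinite_inter_Iio {B : Set OmegaOne} (hB : B.Infinite) :
    ∃ δ, (B ∩ Iio δ).Infinite ∧ ∀ γ < δ, (B ∩ Iio γ).Finite := by
  let e := hB.natEmbedding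
  have hne : {δ : OmegaOne | (B ∩ Iio δ).Infinite}.Nonempty := by
    obtain ⟨b, hb⟩ := exists_forall_lt fun i => (e i : OmegaOne)
    refine ⟨b, (infinite_range_of_injective (Subtype.val_injective.comp e.injective)).mono ?_⟩
    rintro _ ⟨i, rfl⟩
    exact ⟨(e i).2, hb i⟩
  obtain ⟨δ, h1, h2⟩ := WellFounded.has_min (wellFounded_lt (α := OmegaOne)) _ hne
  exact ⟨δ, h1, fun γ hγ => not_infinite.1 fun h => h2 γ h hγ⟩

end OmegaOne

/-! ### Isolating points of a space -/

namespace IsolatedRefinement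

variable {X : Type*} [TopologicalSpace X] {S : Set X}

/-- The identity map from `M(X, S)` to `X`. -/
def toBase (x : IsolatedRefinement X S) : X := x

theorem continuous_toBase : Continuous (toBase : IsolatedRefinement X S → X) :=
  continuous_id_iff_le.2 inf_le_left

theorem isOpen_singleton {x : IsolatedRefinement X S} (hx : x.toBase ∈ S) :
    IsOpen ({x} : Set (IsolatedRefinement X S)) := by
  have h : generateFrom {V : Set X | ∃ x ∈ S, V = {x}} ≥
      (inferInstance : TopologicalSpace (IsolatedRefinement X S)) := inf_le_right
  exact h _ (isOpen_generateFrom_of_mem ⟨_, hx, rfl⟩)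

theorem nhds_of_mem {x : IsolatedRefinement X S} (hx : x.toBase ∈ S) : 𝓝 x = pure x :=
  (isOpen_singleton_iff_nhds_eq_pure x).1 (isOpen_singleton hx)

theorem nhds_of_notMem {x : IsolatedRefinement X S} (hx : x.toBase ∉ S) :
    𝓝 x = comap toBase (𝓝 x.toBase) := by
  have h := nhds_inf (t₁ := ‹TopologicalSpace X›)
    (t₂ := generateFrom {V : Set X | ∃ x ∈ S, V = {x}}) (a := x.toBase)
  have h2 : @nhds X (generateFrom {V : Set X | ∃ x ∈ S, V = {x}}) x.toBase = ⊤ := by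
    rw [nhds_generateFrom]
    refine iInf₂_eq_top.2 ?_
    rintro _ ⟨hxy, y, hy, rfl⟩
    exact absurd (mem_singleton_iff.1 hxy ▸ hy) hx
  rw [h2, inf_top_eq] at h
  exact h.trans comap_id.symm

instance [FirstCountableTopology X] : FirstCountableTopology (IsolatedRefinement X S) where
  nhds_generated_countable x := by
    by_cases hx : x.toBase ∈ S
    · rw [nhds_of_mem hx]
      infer_instance
    · rw [nhds_of_notMem hx]
      infer_instance

end IsolatedRefinement

/-! ### Neighbourhoods of compact sets -/

/-- If the compact sets `K n` converge to the compact set `L`, in the sense that every open set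
around `L` contains almost all of them, then their union with `L` is compact. -/
theorem isCompact_union_iUnion {X : Type*} [TopologicalSpace X] {L : Set X} (hL : IsCompact L)
    {K : ℕ → Set X} (hK : ∀ n, IsCompact (K n))
    (h : ∀ W, IsOpen W → L ⊆ W → ∀ᶠ n in atTop, K n ⊆ W) : IsCompact (L ∪ ⋃ n, K n) := by
  refine isCompact_of_finite_subcover fun {ι} U hU hsub => ?_
  obtain ⟨s, hs⟩ := hL.elim_finite_subcover U hU (subset_union_left.trans hsub)
  obtain ⟨N, hN⟩ := eventually_atTop.1 (h _ (isOpen_biUnion fun i _ => hU i) hs)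
  obtain ⟨t, ht⟩ := ((finite_lt_nat N).isCompact_biUnion fun n _ => hK n).elim_finite_subcover U hU
    ((iUnion₂_subset fun n _ => subset_iUnion K n).trans (subset_union_right.trans hsub))
  classical
  refine ⟨s ∪ t, ?_⟩
  rw [Finset.set_biUnion_union]
  refine union_subset (hs.trans subset_union_left) (iUnion_subset fun n => ?_)
  obtain hn | hn := lt_or_ge n N
  · exact ((subset_biUnion_of_mem (u := K) (show n ∈ {n | n < N} from hn)).trans ht).trans
      subset_union_right
  · exact (hN n hn).trans subset_union_left

/-- Compact sets have a countable base of neighbourhoods in a second countable clopen set `Y`,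
phrased with open sets containing the complement of `Y` so that only the parts inside `Y` matter.
-/
theorem exists_countable_base_of_isCompact {X : Type*} [TopologicalSpace X] {Y : Set X}
    (hY : IsClopen Y) [SecondCountableTopology Y] :
    ∃ V : ℕ → Set X, (∀ n, IsOpen (V n) ∧ Yᶜ ⊆ V n) ∧ ∀ K W, IsCompact K → IsOpen W → K ⊆ W →
      Yᶜ ⊆ W → ∃ n, K ⊆ V n ∧ V n ⊆ W := by
  have hc := countable_ofPred_finite_subset (countable_countableBasis Y)
  obtain ⟨f, hf⟩ := hc.exists_eq_range ⟨∅, finite_empty, empty_subset _⟩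
  have hfm : ∀ n, (f n).Finite ∧ f n ⊆ countableBasis Y := fun n => by
    have : f n ∈ range f := ⟨n, rfl⟩
    rwa [← hf] at this
  refine ⟨fun n => Yᶜ ∪ Subtype.val '' ⋃₀ f n, fun n => ⟨?_, subset_union_left⟩, ?_⟩
  · exact hY.compl.isOpen.union (hY.isOpen.isOpenMap_subtype_val _
      (isOpen_sUnion fun u hu => isOpen_of_mem_countableBasis ((hfm n).2 hu)))
  intro K W hK hW hKW hYW
  have hK' : IsCompact (Subtype.val ⁻¹' K : Set Y) :=
    hY.isClosed.isClosedEmbedding_subtypeVal.isCompact_preimage hK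
  obtain ⟨g, hgb, hg⟩ :=
    (isBasis_countableBasis Y).open_eq_sUnion (hW.preimage continuous_subtype_val)
  obtain ⟨t, htg, htf, htK⟩ := hK'.elim_finite_subcover_image (b := g) (c := id)
    (fun u hu => isOpen_of_mem_countableBasis (hgb hu))
    ((preimage_mono hKW).trans (hg.trans sUnion_eq_biUnion).subset)
  obtain ⟨n, rfl⟩ : t ∈ range f := hf ▸ ⟨htf, htg.trans hgb⟩
  refine ⟨n, fun x hx => ?_, union_subset hYW ?_⟩
  · by_cases hxY : x ∈ Y
    · exact Or.inr ⟨⟨x, hxY⟩, by rw [sUnion_eq_biUnion]; exact htK hx, rfl⟩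
    · exact Or.inl hxY
  · rw [image_subset_iff, hg]
    exact sUnion_subset_sUnion htg

/-! ### Uncountable families of compact sets -/

/-- The key to calibre `(ω₁, ω)`. Let `p : X → ω₁` be continuous with second countable preimages
of initial segments, and consider compact subsets of `Z`. Suppose that, for stationarily many `δ`
that are limits, some compact `F` (the part of the fibre over `δ` that is met by the closure of `Z`,
say) has only neighbourhoods that contain everything in `Z` that lies over a final segment of `δ`.
Then every uncountable family of compact subsets of `Z` has an infinite subfamily with a compact
upper bound.
-/
theorem exists_infinite_bddAbove_compacts {X : Type*} [TopologicalSpace X] {p : X → OmegaOne}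
    (hp : Continuous p) (hsc : ∀ γ, SecondCountableTopology (p ⁻¹' Iic γ))
    {Z : Set X} {T : Set OmegaOne} (hT : IsStationary T)
    (hZ : ∀ δ ∈ T, Order.IsSuccLimit δ → ∃ F, IsCompact F ∧
      ∀ W, IsOpen W → F ⊆ W → ∃ γ < δ, Z ∩ p ⁻¹' Ioo γ δ ⊆ W)
    {A : Set (Compacts X)} (hA : ¬ A.Countable) (hAZ : ∀ K ∈ A, (K : Set X) ⊆ Z) :
    ∃ B ⊆ A, B.Infinite ∧ BddAbove B := by
  obtain ⟨K, hKA, hKinj⟩ : ∃ K : OmegaOne → Compacts X, (∀ α, K α ∈ A) ∧ K.Injective := by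
    have h : lift #OmegaOne ≤ lift #A := by
      rw [OmegaOne.mk_eq, lift_aleph, Ordinal.lift_one, ← succ_aleph0, Order.succ_le_iff]
      simpa using lt_of_not_ge (mt le_aleph0_iff_set_countable.1 hA)
    obtain ⟨e⟩ := lift_mk_le'.1 h
    exact ⟨fun α => e α, fun α => (e α).2, Subtype.val_injective.comp e.injective⟩
  have hb : ∀ α, ∃ b, (K α : Set X) ⊆ p ⁻¹' Iic b := fun α => by
    obtain ⟨b, hb⟩ := ((K α).isCompact.image hp).bddAbove
    exact ⟨b, fun x hx => hb ⟨x, hx, rfl⟩⟩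
  choose b hb using hb
  have hcl (γ : OmegaOne) : IsClopen (p ⁻¹' Iic γ) := (OmegaOne.isClopen_Iic γ).preimage hp
  choose V hV hVb using fun γ => exists_countable_base_of_isCompact (hcl γ)
  -- If `V γ j` contains a member of the family with index above `γ`, then it contains one with
  -- index, and bound for the image in `ω₁`, below `g γ`.
  have hg : ∀ γ, ∃ c, ∀ j, (∃ α, γ < α ∧ (K α : Set X) ⊆ V γ j) →
      ∃ α, γ < α ∧ α < c ∧ b α < c ∧ (K α : Set X) ⊆ V γ j := fun γ => by
    let ι := {j // ∃ α, γ < α ∧ (K α : Set X) ⊆ V γ j}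
    choose a ha using fun j : ι => j.2
    obtain ⟨c, hc⟩ := OmegaOne.exists_forall_lt fun j : ι => max (a j) (b (a j))
    exact ⟨c, fun j hj => ⟨a ⟨j, hj⟩, (ha _).1, (max_lt_iff.1 (hc ⟨j, hj⟩)).1,
      (max_lt_iff.1 (hc ⟨j, hj⟩)).2, (ha _).2⟩⟩
  choose g hg using hg
  obtain ⟨δ, hδT, hδ, hδg⟩ := hT (OmegaOne.isClub_setOf_closed g)
  obtain ⟨F, hF, hFW⟩ := hZ δ hδT hδ
  -- `K δ` itself witnesses that `hg` applies to each neighbourhood of `K δ` over `γ < δ`. The sets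
  -- `D c` of indices below `δ` found in this way generate a filter along which the `K α` converge
  -- to `K δ` below `δ`.
  let ι := {c : Iio δ × ℕ // (K δ : Set X) ⊆ V c.1 c.2}
  have : Countable (Iio δ) := OmegaOne.countable_Iio δ
  have : Countable ι := Subtype.countable
  let D : ι → Set OmegaOne := fun c =>
    {α | c.1.1 < α ∧ α < δ ∧ b α < δ ∧ (K α : Set X) ⊆ V c.1.1 c.1.2}
  have hD : ∀ c, (D c).Nonempty := fun ⟨⟨⟨γ, hγ⟩, j⟩, hc⟩ => by
    obtain ⟨α, h1, h2, h3, h4⟩ := hg γ j ⟨δ, hγ, hc⟩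
    exact ⟨α, h1, h2.trans (hδg γ hγ), h3.trans (hδg γ hγ), h4⟩
  have hDex : ∀ γ < δ, ∀ W, IsOpen W → (K δ : Set X) ⊆ W → (p ⁻¹' Iic γ)ᶜ ⊆ W →
      ∃ c, ∀ α ∈ D c, γ < α ∧ α < δ ∧ b α < δ ∧ (K α : Set X) ⊆ W := fun γ hγ W hW hKW hγW => by
    obtain ⟨j, h1, h2⟩ := hVb γ (K δ) W (K δ).isCompact hW hKW hγW
    exact ⟨⟨⟨⟨γ, hγ⟩, j⟩, h1⟩, fun α hα => ⟨hα.1, hα.2.1, hα.2.2.1, hα.2.2.2.trans h2⟩⟩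
  have hdir : Directed (· ≥ ·) fun c => 𝓟 (D c) := by
    rintro ⟨⟨⟨γ, hγ⟩, i⟩, hi⟩ ⟨⟨⟨γ', hγ'⟩, j⟩, hj⟩
    have hmono : ∀ γ₁ ≤ max γ γ', (p ⁻¹' Iic (max γ γ'))ᶜ ⊆ (p ⁻¹' Iic γ₁)ᶜ := fun γ₁ h =>
      compl_subset_compl.2 (preimage_mono (Iic_subset_Iic.2 h))
    obtain ⟨c, hc⟩ := hDex (max γ γ') (max_lt hγ hγ') (V γ i ∩ V γ' j)
      ((hV γ i).1.inter (hV γ' j).1) (subset_inter hi hj)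
      (subset_inter ((hmono _ (le_max_left _ _)).trans (hV γ i).2)
        ((hmono _ (le_max_right _ _)).trans (hV γ' j).2))
    refine ⟨c, principal_mono.2 fun α hα => ?_, principal_mono.2 fun α hα => ?_⟩
    · obtain ⟨h1, h2, h3, h4⟩ := hc α hα
      exact ⟨(le_max_left _ _).trans_lt h1, h2, h3, h4.trans inter_subset_left⟩
    · obtain ⟨h1, h2, h3, h4⟩ := hc α hα
      exact ⟨(le_max_right _ _).trans_lt h1, h2, h3, h4.trans inter_subset_right⟩
  have hev : ∀ γ < δ, ∃ c, ∀ α ∈ D c, γ < α ∧ α < δ := fun γ hγ => by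
    obtain ⟨c, hc⟩ := hDex γ hγ univ isOpen_univ (subset_univ _) (subset_univ _)
    exact ⟨c, fun α hα => ⟨(hc α hα).1, (hc α hα).2.1⟩⟩
  obtain ⟨γ₀, hγ₀⟩ : ∃ γ₀, γ₀ < δ := not_isMin_iff.1 hδ.not_isMin
  have : Nonempty ι := let ⟨c, _⟩ := hev γ₀ hγ₀; ⟨c⟩
  have : (⨅ c, 𝓟 (D c)).NeBot :=
    iInf_neBot_of_directed' hdir fun c => principal_neBot_iff.2 (hD c)
  obtain ⟨a, ha⟩ := exists_seq_tendsto (⨅ c, 𝓟 (D c))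
  have hmem : ∀ c, ∀ᶠ n in atTop, a n ∈ D c := fun c => by
    simpa using (tendsto_iInf.1 ha c)
  -- The shift by `N` puts all indices and images below `δ`, not just almost all of them.
  obtain ⟨N, hN⟩ := eventually_atTop.1 (hmem (Classical.arbitrary ι))
  replace hN : ∀ n, a (n + N) < δ ∧ b (a (n + N)) < δ := fun n =>
    ⟨(hN _ (Nat.le_add_left N n)).2.1, (hN _ (Nat.le_add_left N n)).2.2.1⟩
  replace hmem : ∀ c, ∀ᶠ n in atTop, a (n + N) ∈ D c := fun c =>
    (tendsto_add_atTop_nat N).eventually (hmem c)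
  have hinf : (range fun n => a (n + N)).Infinite := fun hfin => by
    obtain ⟨_, ⟨k, rfl⟩, hk⟩ := hfin.exists_maximal (range_nonempty _)
    obtain ⟨c, hc⟩ := hev _ (hN k).1
    obtain ⟨n, hn⟩ := (hmem c).exists
    exact (hc _ hn).1.not_ge (hk ⟨n, rfl⟩ (hc _ hn).1.le)
  have hcpt : IsCompact (((K δ : Set X) ∩ p ⁻¹' Iic δ ∪ F) ∪ ⋃ n, (K (a (n + N)) : Set X)) := by
    refine isCompact_union_iUnion (((K δ).isCompact.inter_right (hcl δ).isClosed).union hF)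
      (fun n => (K _).isCompact) fun W hW hLW => ?_
    obtain ⟨γ, hγ, hγW⟩ := hFW W hW (subset_union_right.trans hLW)
    obtain ⟨c, hc⟩ := hDex γ hγ (W ∪ (p ⁻¹' Iic γ)ᶜ) (hW.union (hcl γ).compl.isOpen)
      (fun x hx => (le_or_gt (p x) δ).imp (fun h => hLW (Or.inl ⟨hx, h⟩))
        fun h => (hγ.trans h).not_ge) subset_union_right
    filter_upwards [hmem c] with n hn x hx
    obtain ⟨-, -, h3, h4⟩ := hc _ hn
    exact (h4 hx).elim id fun h =>
      hγW ⟨hAZ _ (hKA _) hx, not_le.1 h, (hb _ hx).trans_lt h3⟩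
  refine ⟨K '' range fun n => a (n + N), ?_, hinf.image hKinj.injOn, ⟨⟨_, hcpt⟩, ?_⟩⟩
  · rintro _ ⟨_, _, rfl⟩
    exact hKA _
  · rintro _ ⟨_, ⟨n, rfl⟩, rfl⟩
    exact (subset_iUnion (fun n => (K (a (n + N)) : Set X)) n).trans subset_union_right

theorem isDirectedSet_compacts (X : Type*) [TopologicalSpace X] : IsDirectedSet (Compacts X) :=
  fun _ hF => hF.bddAbove

theorem secondCountableTopology_preimage_Iic {X : Type*} [TopologicalSpace X]
    [FirstCountableTopology X] {p : X → OmegaOne} (hp : ∀ α, (p ⁻¹' {α}).Countable)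
    (γ : OmegaOne) : SecondCountableTopology (p ⁻¹' Iic γ) := by
  have : Countable (p ⁻¹' Iic γ) := by
    rw [← biUnion_preimage_singleton]
    exact (OmegaOne.countable_Iic γ).biUnion fun α _ => hp α
  infer_instance

theorem HasCalibre.exists_infinite_bddAbove_image {P : Type*} [PartialOrder P] (h : HasCalibre P)
    {f : OmegaOne → P} (hf : f.Injective) : ∃ B : Set OmegaOne, B.Infinite ∧ BddAbove (f '' B) := by
  obtain ⟨B, hB, hBi, hbdd⟩ := h (range f) fun hc => not_countable (α := OmegaOne)
    (countable_univ_iff.1 (countable_of_injective_of_countable_image hf.injOn (image_univ ▸ hc)))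
  refine ⟨f ⁻¹' B, hBi.preimage hB, ?_⟩
  rwa [image_preimage_eq_of_subset hB]

/-! ### Compact sets in `M(ω₁, S)` -/

namespace IsolatedRefinement

theorem exists_preimage_Ioo_subset {S : Set OmegaOne} {δ : IsolatedRefinement OmegaOne S}
    (hδ : Order.IsSuccLimit δ.toBase) (hδS : δ.toBase ∉ S)
    {W : Set (IsolatedRefinement OmegaOne S)} (hW : W ∈ 𝓝 δ) :
    ∃ γ < δ.toBase, toBase ⁻¹' Ioo γ δ.toBase ⊆ W := by
  rw [nhds_of_notMem hδS, mem_comap] at hW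
  obtain ⟨U, hU, hUW⟩ := hW
  obtain ⟨γ, hγ, h⟩ := OmegaOne.exists_Ioc_subset_of_mem_nhds hδ hU
  exact ⟨γ, hγ, (preimage_mono (Ioo_subset_Ioc_self.trans h)).trans hUW⟩

/-- If stationarily many limit ordinals are not isolated in `M(ω₁, S)`, then `𝒦(M(ω₁, S))` has
calibre `(ω₁, ω)`. -/
theorem hasCalibre_compacts {S T : Set OmegaOne} (hT : IsStationary T)
    (hST : ∀ δ ∈ T, Order.IsSuccLimit δ → δ ∉ S) :
    HasCalibre (Compacts (IsolatedRefinement OmegaOne S)) := fun A hA => by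
  refine exists_infinite_bddAbove_compacts continuous_toBase
    (secondCountableTopology_preimage_Iic fun α => (countable_singleton α))
    (Z := univ) hT (fun δ hδT hδ => ?_) hA fun K _ => subset_univ _
  let δ' : IsolatedRefinement OmegaOne S := δ
  refine ⟨{δ'}, isCompact_singleton, fun W hW hδW => ?_⟩
  obtain ⟨γ, hγ, h⟩ := exists_preimage_Ioo_subset (δ := δ') hδ (hST δ hδT hδ)
    (hW.mem_nhds (singleton_subset_iff.1 hδW))
  exact ⟨γ, hγ, inter_subset_right.trans h⟩

/-- A compact subset of `M(ω₁, S)` that contains a set `B` accumulating at `δ` from below forces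
`δ ∉ S`: were `δ` isolated, `[0, δ)` would be closed in `M(ω₁, S)`, so the part of the compact set
below `δ` would have a greatest element `m < δ`, and only finitely many elements of `B` would lie
below `δ`. -/
theorem notMem_of_isCompact {S : Set OmegaOne} {K : Set (IsolatedRefinement OmegaOne S)}
    (hK : IsCompact K) {B : Set OmegaOne} (hBK : toBase ⁻¹' B ⊆ K) {δ : OmegaOne}
    (hinf : (B ∩ Iio δ).Infinite) (hfin : ∀ γ < δ, (B ∩ Iio γ).Finite) : δ ∉ S := fun hδ => by
  let δ' : IsolatedRefinement OmegaOne S := δ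
  have hcl : IsClosed (toBase ⁻¹' Iio δ : Set (IsolatedRefinement OmegaOne S)) := by
    have h : (toBase ⁻¹' Iio δ : Set (IsolatedRefinement OmegaOne S)) =
        toBase ⁻¹' Iic δ ∩ {δ'}ᶜ := by
      rw [← Iic_sdiff_right]
      rfl
    rw [h]
    exact (isClosed_Iic.preimage continuous_toBase).inter
      (isOpen_singleton (x := δ') hδ).isClosed_compl
  have hsub : B ∩ Iio δ ⊆ toBase '' (K ∩ toBase ⁻¹' Iio δ) := fun x hx => ⟨x, ⟨hBK hx.1, hx.2⟩, rfl⟩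
  obtain ⟨m, ⟨y, hy, rfl⟩, hm⟩ := ((hK.inter_right hcl).image continuous_toBase).exists_isGreatest
    (hinf.nonempty.mono hsub)
  refine hinf (((hfin _ hy.2).union (finite_singleton y.toBase)).subset fun x hx => ?_)
  exact (hm (hsub hx)).lt_or_eq.imp (fun h => ⟨hx.1, h⟩) fun h => h

end IsolatedRefinement

/-! ### Compact sets in the sum space -/

open IsolatedRefinement

namespace SumSpace

variable {S : ℕ → Set OmegaOne}

instance : FirstCountableTopology (SumSpace S) where
  nhds_generated_countable x := by
    rw [Sigma.nhds_eq]
    infer_instance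

/-- The inclusion of the `n`-th summand. -/
def incl (S : ℕ → Set OmegaOne) (n : ℕ) :
    IsolatedRefinement OmegaOne (S n ∪ isolatedPoints OmegaOne) → SumSpace S :=
  fun x => ⟨n, x⟩

theorem isClosedEmbedding_incl (n : ℕ) : IsClosedEmbedding (incl S n) :=
  IsClosedEmbedding.sigmaMk
    (σ := fun n => IsolatedRefinement OmegaOne (S n ∪ isolatedPoints OmegaOne))

/-- The map from the sum to `ω₁` that forgets the summand. -/
def proj (x : SumSpace S) : OmegaOne := x.2.toBase

theorem continuous_proj : Continuous (proj : SumSpace S → OmegaOne) :=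
  continuous_sigma fun _ => continuous_toBase

theorem countable_preimage_proj (α : OmegaOne) :
    ((proj : SumSpace S → OmegaOne) ⁻¹' {α}).Countable := by
  refine (countable_range fun n : ℕ => incl S n α).mono ?_
  rintro ⟨n, β⟩ (h : β = α)
  exact ⟨n, by rw [← h]; rfl⟩

theorem exists_subset_of_isCompact {K : Set (SumSpace S)} (hK : IsCompact K) :
    ∃ m : ℕ, K ⊆ {x | x.1 ≤ m} := by
  have hc : Continuous (Sigma.fst : SumSpace S → ℕ) := continuous_sigma fun _ => continuous_const
  obtain ⟨m, hm⟩ := (hK.image hc).bddAbove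
  exact ⟨m, fun x hx => hm ⟨x, hx, rfl⟩⟩

/-- Uncountably many members of the family lie in the first `m + 1` summands, where the limit
points in `S (m + 1)` are not isolated. -/
theorem hasCalibre_compacts (hS : IsStationaryPartition S) :
    HasCalibre (Compacts (SumSpace S)) := fun A hA => by
  obtain ⟨m, hm⟩ : ∃ m, ¬ {K ∈ A | (K : Set (SumSpace S)) ⊆ {x | x.1 ≤ m}}.Countable := by
    by_contra! h
    refine hA ((countable_iUnion h).mono fun K hK => mem_iUnion.2 ?_)
    exact (exists_subset_of_isCompact K.isCompact).imp fun m hm => ⟨hK, hm⟩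
  suffices h : ∃ B ⊆ {K ∈ A | (K : Set (SumSpace S)) ⊆ {x | x.1 ≤ m}}, B.Infinite ∧ BddAbove B from
    h.imp fun B hB => ⟨hB.1.trans (sep_subset _ _), hB.2⟩
  refine exists_infinite_bddAbove_compacts continuous_proj
    (secondCountableTopology_preimage_Iic countable_preimage_proj) (hS.stationary (m + 1))
    (fun δ hδT hδ => ?_) hm fun K hK => hK.2
  refine ⟨(fun n : ℕ => incl S n δ) '' Iic m, ((finite_Iic m).image _).isCompact,
    fun W hW hFW => ?_⟩
  have hγ : ∀ n : Iic m, ∃ γ < δ, toBase ⁻¹' Ioo γ δ ⊆ incl S n ⁻¹' W := fun ⟨n, hn⟩ => by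
    refine exists_preimage_Ioo_subset (S := S n ∪ isolatedPoints OmegaOne) (δ := δ) hδ ?_
      ((hW.preimage (isClosedEmbedding_incl n).continuous).mem_nhds (hFW ⟨n, hn, rfl⟩))
    rintro (h | h)
    · exact Set.disjoint_left.1 (hS.disjoint (Nat.lt_succ_of_le hn).ne) h hδT
    · exact OmegaOne.notMem_isolatedPoints hδ h
  choose γ hγδ hγ using hγ
  obtain ⟨k, hk⟩ := Finite.exists_max γ
  refine ⟨γ k, hγδ k, ?_⟩
  rintro ⟨n, x⟩ ⟨hn, hx⟩
  exact hγ ⟨n, hn⟩ ⟨(hk _).trans_lt hx.1, hx.2⟩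

/-- The singleton of the copy of `α` in the `n`-th summand. -/
def single (S : ℕ → Set OmegaOne) (n : ℕ) (α : OmegaOne) : Compacts (SumSpace S) :=
  ⟨{incl S n α}, isCompact_singleton⟩

theorem single_injective (n : ℕ) : (single S n).Injective := fun _ _ h =>
  (isClosedEmbedding_incl n).injective (singleton_injective (congrArg Compacts.carrier h))

theorem notMem_of_single_le {n : ℕ} {K : Compacts (SumSpace S)} {B : Set OmegaOne}
    (hBK : ∀ α ∈ B, single S n α ≤ K) {δ : OmegaOne}
    (hinf : (B ∩ Iio δ).Infinite) (hfin : ∀ γ < δ, (B ∩ Iio γ).Finite) : δ ∉ S n := fun hδ =>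
  notMem_of_isCompact ((isClosedEmbedding_incl n).isCompact_preimage K.isCompact)
    (fun α hα => hBK α hα (mem_singleton _)) hinf hfin (mem_union_left _ hδ)

theorem not_isPowerfullyCalibre (hS : IsStationaryPartition S) :
    ¬ IsPowerfullyCalibre (Compacts (SumSpace S)) := fun h => by
  obtain ⟨B, hB, K, hK⟩ := h.exists_infinite_bddAbove_image
    (f := fun (α : OmegaOne) (n : ℕ) => single S n α)
    fun α β h => single_injective 0 (congrFun h 0)
  obtain ⟨δ, hinf, hfin⟩ := OmegaOne.exists_infinite_inter_Iio hB
  obtain ⟨n, hn⟩ := mem_iUnion.1 (hS.iUnion_eq.symm ▸ mem_univ δ : δ ∈ ⋃ n, S n)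
  exact notMem_of_single_le (fun α hα => hK ⟨α, hα, rfl⟩ n) hinf hfin hn

theorem not_isProductivelyCalibre (hS : IsStationaryPartition S) :
    ¬ IsProductivelyCalibre (Compacts (SumSpace S)) := fun h => by
  -- The second factor isolates the points outside `S 0`, while the summand with index `0` isolates
  -- those in `S 0`.
  let s (α : OmegaOne) : Compacts (IsolatedRefinement OmegaOne (S 0)ᶜ) :=
    ⟨toBase ⁻¹' {α}, isCompact_singleton⟩
  have hprod := h (Compacts (IsolatedRefinement OmegaOne (S 0)ᶜ)) (isDirectedSet_compacts _)
    (IsolatedRefinement.hasCalibre_compacts (hS.stationary 0) fun δ hδ _ => not_not.2 hδ)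
  obtain ⟨B, hB, ⟨K, L⟩, hKL⟩ := hprod.exists_infinite_bddAbove_image
    (f := fun α => (single S 0 α, s α)) fun α β h => single_injective 0 (congrArg Prod.fst h)
  obtain ⟨δ, hinf, hfin⟩ := OmegaOne.exists_infinite_inter_Iio hB
  have h0 : δ ∉ S 0 := notMem_of_single_le (fun α hα => (hKL ⟨α, hα, rfl⟩).1) hinf hfin
  exact notMem_of_isCompact L.isCompact (fun α hα => (hKL ⟨α, hα, rfl⟩).2 rfl) hinf hfin h0

end SumSpace

/-- `TopologicalSpace.Compacts X` is the set `𝒦(X)` of all compact subsets of `X`, ordered by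
inclusion. -/
theorem mainTheorem8 :
    (∃ S : ℕ → Set OmegaOne, IsStationaryPartition S) ∧
    ∀ S : ℕ → Set OmegaOne, IsStationaryPartition S →
      IsDirectedSet (TopologicalSpace.Compacts (SumSpace S)) ∧
      HasCalibre (TopologicalSpace.Compacts (SumSpace S)) ∧
      ¬ IsPowerfullyCalibre (TopologicalSpace.Compacts (SumSpace S)) ∧
      ¬ IsProductivelyCalibre (TopologicalSpace.Compacts (SumSpace S)) :=
  ⟨OmegaOne.exists_isStationaryPartition, fun _ hS => ⟨isDirectedSet_compacts _,
    SumSpace.hasCalibre_compacts hS, SumSpace.not_isPowerfullyCalibre hS,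
    SumSpace.not_isProductivelyCalibre hS⟩⟩
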